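/- Let $\mathbf Z$ be a Dedekind domain, that is, a Noetherian Prüfer domain (for instance an explicit one, i.e. one with a divisibility test); here an integral domain is a Prüfer domain if for every finite family $a_0,\dots,a_n$ in it there are $s_0,\dots,s_n$ in it with $\sum_i s_i=1$ and $s_i\langle a_0,\dots,a_n\rangle\subseteq\langle a_i\rangle$ for all $i$. Let $\mathbf K$ be the field of fractions of $\mathbf Z$. A pseudo-matrix of size $n\times m$ over $\mathbf Z$ is a datum $A=(\mathfrak h_1,\dots,\mathfrak h_n;\mathfrak e_1,\dots,\mathfrak e_m;\underline A)$, where the $\mathfrak h_i$ and $\mathfrak e_j$ are invertible fractional ideals of $\mathbf Z$ and $\underline A=(a_{ij})$ is an $n\times m$ matrix over $\mathbf K$ with $a_{ij}\mathfrak e_j\subseteq\mathfrak h_i$ for all $i,j$. The product of $(\underline{\mathfrak c};\underline{\mathfrak h};\underline B)$ and $(\underline{\mathfrak h};\underline{\mathfrak e};\underline A)$ is $(\underline{\mathfrak c};\underline{\mathfrak e};\underline B\,\underline A)$. A square pseudo-matrix $(\underline{\mathfrak h};\underline{\mathfrak e};\underline A)$ is invertible if there is a pseudo-matrix $(\underline{\mathfrak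 e};\underline{\mathfrak h};\underline B)$ with $\underline A\,\underline B=\underline B\,\underline A=I$. Two pseudo-matrices $A=(\underline{\mathfrak h};\underline{\mathfrak e};\underline A)$ and $A'=(\underline{\mathfrak h}';\underline{\mathfrak e}';\underline A')$ of the same size are equivalent if $A'=L\,A\,C$ for some invertible pseudo-matrices $L=(\underline{\mathfrak h}';\underline{\mathfrak h};\underline L)$ and $C=(\underline{\mathfrak e};\underline{\mathfrak e}';\underline C)$. An $n\times m$ pseudo-matrix $A$ is in Smith form if $a_{ij}=0$ whenever $i\ne j$ and, with $p=\min(n,m)$, the diagonal minor ideals of order one $\mathfrak c_i:=a_{ii}\,\mathfrak e_i\,\mathfrak h_i^{-1}$ satisfy $\mathfrak c_1\supseteq\mathfrak c_2\supseteq\cdots\supseteq\mathfrak c_p$. Then every pseudo-matrix over $\mathbf Z$ is equivalent to a pseudo-matrix in Smith form. -/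

import Mathlib

open scoped nonZeroDivisors

/-- A Prüfer domain is an integral domain which is arithmetical: every finitely generated ideal
`⟨a₀, …, aₙ⟩` is locally principal, i.e. there are `s₀, …, sₙ` with sum `1` such that
`sᵢ ⟨a₀, …, aₙ⟩ ⊆ ⟨aᵢ⟩` for each `i`. -/
structure IsPruferDomain (Z : Type*) [CommRing Z] : Prop where
  isDomain : IsDomain Z
  locallyPrincipal : ∀ (n : ℕ) (a : Fin (n + 1) → Z), ∃ s : Fin (n + 1) → Z,
    ∑ i, s i = 1 ∧
      ∀ i, ∀ x ∈ Ideal.span (Set.range a), s i * x ∈ Ideal.span {a i}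

/-- Pseudo-matrices `(h₁, …, hₙ; e₁, …, eₘ; A)` over a domain `Z` with field of fractions `K`.
The `hᵢ` (row indices) and `eⱼ` (column indices) are invertible fractional ideals of `Z`, and `A`
is an `n × m` matrix over `K` such that `aᵢⱼ eⱼ ⊆ hᵢ` for all `i, j`. -/
@[ext]
structure PseudoMatrix {Z : Type*} [CommRing Z] {K : Type*} [Field K] [Algebra Z K]
    {n m : ℕ} (h : Fin n → (FractionalIdeal Z⁰ K)ˣ) (e : Fin m → (FractionalIdeal Z⁰ K)ˣ) where
  mat : Matrix (Fin n) (Fin m) K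
  mul_mem : ∀ i j, ∀ x ∈ (e j : FractionalIdeal Z⁰ K),
    mat i j * x ∈ (h i : FractionalIdeal Z⁰ K)

namespace PseudoMatrix

variable {Z : Type*} [CommRing Z] {K : Type*} [Field K] [Algebra Z K]

/-- The product `(c; h; B) · (h; e; A) = (c; e; B A)`. -/
def mul {l n m : ℕ} {c : Fin l → (FractionalIdeal Z⁰ K)ˣ} {h : Fin n → (FractionalIdeal Z⁰ K)ˣ}
    {e : Fin m → (FractionalIdeal Z⁰ K)ˣ} (B : PseudoMatrix c h) (A : PseudoMatrix h e) :
    PseudoMatrix c e where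
  mat := B.mat * A.mat
  mul_mem i j x hx := by
    rw [Matrix.mul_apply, Finset.sum_mul, ← FractionalIdeal.mem_coe]
    refine Submodule.sum_mem _ fun k _ => ?_
    rw [mul_assoc]
    exact B.mul_mem i k _ (A.mul_mem k j x hx)

/-- The identity pseudo-matrix `(e; e; I)`. -/
def one {n : ℕ} (e : Fin n → (FractionalIdeal Z⁰ K)ˣ) : PseudoMatrix e e where
  mat := 1
  mul_mem i j x hx := by
    by_cases hij : i = j
    · subst hij
      simpa using hx
    · rw [Matrix.one_apply_ne hij, zero_mul]
      exact FractionalIdeal.zero_mem _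

/-- A square pseudo-matrix `(h; e; A)` is invertible if it has a two-sided inverse which is a
pseudo-matrix `(e; h; B)`. -/
def IsInvertible {n : ℕ} {h e : Fin n → (FractionalIdeal Z⁰ K)ˣ} (A : PseudoMatrix h e) : Prop :=
  ∃ B : PseudoMatrix e h, A.mul B = one h ∧ B.mul A = one e

/-- Two pseudo-matrices `A = (h; e; A)` and `A' = (h'; e'; A')` of the same size are equivalent if
`A' = L A C` for some invertible pseudo-matrices `L` and `C`, the changes of pseudo-bases of the
target and of the source. -/
def Equivalent {n m : ℕ} {h h' : Fin n → (FractionalIdeal Z⁰ K)ˣ}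
    {e e' : Fin m → (FractionalIdeal Z⁰ K)ˣ} (A : PseudoMatrix h e) (A' : PseudoMatrix h' e') :
    Prop :=
  ∃ (L : PseudoMatrix h' h) (C : PseudoMatrix e e'),
    L.IsInvertible ∧ C.IsInvertible ∧ (L.mul A).mul C = A'

/-- The minor ideal of order one `aᵢⱼ eⱼ hᵢ⁻¹`. -/
noncomputable def minorIdeal [IsFractionRing Z K] {n m : ℕ}
    {h : Fin n → (FractionalIdeal Z⁰ K)ˣ} {e : Fin m → (FractionalIdeal Z⁰ K)ˣ}
    (A : PseudoMatrix h e) (i : Fin n) (j : Fin m) : FractionalIdeal Z⁰ K :=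
  FractionalIdeal.spanSingleton Z⁰ (A.mat i j) * (e j : FractionalIdeal Z⁰ K) *
    (((h i)⁻¹ : (FractionalIdeal Z⁰ K)ˣ) : FractionalIdeal Z⁰ K)

/-- A pseudo-matrix is in Smith form if all its entries off the diagonal vanish and, with
`p = min n m`, its diagonal minor ideals of order one `cᵢ` satisfy `c₁ ⊇ c₂ ⊇ ⋯ ⊇ cₚ`. -/
def IsSmith [IsFractionRing Z K] {n m : ℕ}
    {h : Fin n → (FractionalIdeal Z⁰ K)ˣ} {e : Fin m → (FractionalIdeal Z⁰ K)ˣ}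
    (A : PseudoMatrix h e) : Prop :=
  (∀ (i : Fin n) (j : Fin m), (i : ℕ) ≠ (j : ℕ) → A.mat i j = 0) ∧
    Antitone fun k : Fin (min n m) =>
      A.minorIdeal (Fin.castLE (min_le_left n m) k) (Fin.castLE (min_le_right n m) k)

end PseudoMatrix

/-!
By Noetherianity, some pseudo-matrix equivalent to `A` has a maximal minor ideal at `(1, 1)`. The
sum of two minor ideals of one column is invertible, and a relation `a u + b v = 1` expressing this
fills a `2 × 2` block of determinant `1`, which puts the sum in the place of the first of the two.
Maximality therefore forces the minor ideal at `(1, 1)` to contain those of its column and, by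
transposition, those of its row, so the rest of this row and column can be cleared. Adding to the
first row a multiple `t` of the `i`-th row, with `t ∈ h₁ hᵢ⁻¹`, then leaves the first column alone,
so the minor ideal at `(1, 1)` contains all the others. Equivalences cannot enlarge the sum of all
minor ideals, hence this containment survives the reduction of the remaining block.

Row operations change the ideals `hᵢ`, so their invertibility is checked on determinants:
by Cramer's rule, `(h; e; A)` is invertible as soon as `(det A) ∏ eᵢ = ∏ hᵢ`.
-/

open FractionalIdeal

section FractionalIdeals

variable {Z : Type*} [CommRing Z] {K : Type*} [Field K] [Algebra Z K] [IsFractionRing Z K]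

lemma div_mem_inv_coeIdeal [IsDomain Z] {I : Ideal Z} (hI : I ≠ ⊥) {s a : Z}
    (h : ∀ x ∈ I, a ∣ s * x) :
    algebraMap Z K s / algebraMap Z K a ∈ (I : FractionalIdeal Z⁰ K)⁻¹ := by
  rw [mem_inv_iff (coeIdeal_ne_zero.2 hI)]
  intro y hy
  obtain ⟨x, hx, rfl⟩ := (mem_coeIdeal _).1 hy
  rcases eq_or_ne (algebraMap Z K a) 0 with ha | ha
  · simp [ha]
  obtain ⟨z, hz⟩ := h x hx
  refine (mem_one_iff _).2 ⟨z, ?_⟩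
  rw [div_mul_eq_mul_div, ← map_mul, hz, map_mul, mul_div_cancel_left₀ _ ha]

lemma isUnit_of_sum_mul_eq_one [IsDomain Z] {ι : Type*} (t : Finset ι)
    {I : FractionalIdeal Z⁰ K} {x y : ι → K} (hx : ∀ i ∈ t, x i ∈ I) (hy : ∀ i ∈ t, y i ∈ I⁻¹)
    (hxy : ∑ i ∈ t, x i * y i = 1) : IsUnit I := by
  have hI : I ≠ 0 := by
    rintro rfl
    rw [Finset.sum_eq_zero fun i hi => by rw [(mem_zero_iff _).1 (hx i hi), zero_mul]] at hxy
    exact zero_ne_one hxy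
  rw [← mul_inv_cancel_iff_isUnit]
  refine le_antisymm (mul_le.2 fun z hz w hw => ?_) (one_le.2 ?_)
  · rw [mul_comm]
    exact (mem_inv_iff hI).1 hw z hz
  · rw [← hxy, ← mem_coe]
    exact Submodule.sum_mem _ fun i hi => mul_mem_mul (hx i hi) (hy i hi)

lemma spanSingleton_sum_mul_le {ι : Type*} (s : Finset ι) (x : ι → K) {I J : FractionalIdeal Z⁰ K}
    (hx : ∀ i ∈ s, spanSingleton Z⁰ (x i) * I ≤ J) : spanSingleton Z⁰ (∑ i ∈ s, x i) * I ≤ J := by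
  refine spanSingleton_mul_le_iff.2 fun y hy => ?_
  rw [Finset.sum_mul, ← mem_coe]
  exact Submodule.sum_mem _ fun i hi => spanSingleton_mul_le_iff.1 (hx i hi) y hy

lemma spanSingleton_prod {ι : Type*} (s : Finset ι) (x : ι → K) :
    spanSingleton Z⁰ (∏ i ∈ s, x i) = ∏ i ∈ s, spanSingleton Z⁰ (x i) :=
  map_prod (⟨⟨spanSingleton Z⁰, spanSingleton_one⟩,
    fun x y => (spanSingleton_mul_spanSingleton x y).symm⟩ : K →* FractionalIdeal Z⁰ K) x s

lemma spanSingleton_neg (x : K) : spanSingleton Z⁰ (-x) = spanSingleton Z⁰ x :=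
  coeToSubmodule_inj.1 <| by
    rw [coe_spanSingleton, coe_spanSingleton, ← Set.neg_singleton, Submodule.span_neg]

lemma spanSingleton_add_mul_le {x y : K} {I J : FractionalIdeal Z⁰ K}
    (hx : spanSingleton Z⁰ x * I ≤ J) (hy : spanSingleton Z⁰ y * I ≤ J) :
    spanSingleton Z⁰ (x + y) * I ≤ J := by
  simpa using spanSingleton_sum_mul_le Finset.univ ![x, y] (by simp [Fin.forall_fin_two, hx, hy])

lemma spanSingleton_mul_units_le_iff {x : K} {u : (FractionalIdeal Z⁰ K)ˣ}
    {J : FractionalIdeal Z⁰ K} :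
    spanSingleton Z⁰ x * u ≤ J ↔ x ∈ J * (u⁻¹ : (FractionalIdeal Z⁰ K)ˣ) := by
  rw [← Units.le_mul_inv_iff, spanSingleton_le_iff_mem]

lemma exists_mul_add_mul_eq_one {a b : K} {I J : FractionalIdeal Z⁰ K}
    (h : spanSingleton Z⁰ a * I + spanSingleton Z⁰ b * J = 1) :
    ∃ u ∈ I, ∃ v ∈ J, a * u + b * v = 1 := by
  obtain ⟨x, hx, y, hy, hxy⟩ := (mem_add _ _ _).1 (h ▸ one_mem_one Z⁰)
  obtain ⟨u, hu, rfl⟩ := mem_singleton_mul.1 hx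
  obtain ⟨v, hv, rfl⟩ := mem_singleton_mul.1 hy
  exact ⟨u, hu, v, hv, hxy⟩

end FractionalIdeals

namespace IsPruferDomain

variable {Z : Type*} [CommRing Z] {K : Type*} [Field K] [Algebra Z K] [IsFractionRing Z K]

lemma isUnit_coeIdeal (hZ : IsPruferDomain Z) {J : Ideal Z} (hJ : J ≠ ⊥) (hfg : J.FG) :
    IsUnit (J : FractionalIdeal Z⁰ K) := by
  have := hZ.isDomain
  obtain ⟨n, a, rfl⟩ := Submodule.fg_iff_exists_fin_generating_family.1 hfg
  rcases n with _ | n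
  · exact absurd (by rw [Set.range_eq_empty, Submodule.span_empty]) hJ
  obtain ⟨s, hs, hsa⟩ := hZ.locallyPrincipal n a
  have hdvd : ∀ i, ∀ x ∈ Ideal.span (Set.range a), a i ∣ s i * x := fun i x hx =>
    Ideal.mem_span_singleton.1 (hsa i x hx)
  have hs0 : ∀ i, a i = 0 → s i = 0 := by
    intro i hi
    obtain ⟨x, hxJ, hx0⟩ := Submodule.exists_mem_ne_zero_of_ne_bot hJ
    exact (mul_eq_zero.1 (zero_dvd_iff.1 (hi ▸ hdvd i x hxJ))).resolve_right hx0
  refine isUnit_of_sum_mul_eq_one Finset.univ (x := fun i => algebraMap Z K (a i))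
    (fun i _ => mem_coeIdeal_of_mem _ (Ideal.subset_span ⟨i, rfl⟩))
    (fun i _ => div_mem_inv_coeIdeal hJ (hdvd i)) ?_
  rw [← map_one (algebraMap Z K), ← hs, map_sum]
  refine Finset.sum_congr rfl fun i _ => mul_div_cancel_of_imp' fun hi => ?_
  rw [hs0 i (by simpa using hi), map_zero]

lemma isDedekindDomain [IsNoetherianRing Z] (hZ : IsPruferDomain Z) : IsDedekindDomain Z := by
  have := hZ.isDomain
  refine (isDedekindDomain_iff_mul_inv_cancel (K := FractionRing Z)).2 fun I hI => ?_
  rw [mul_inv_cancel_iff_isUnit, ← isUnit_num]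
  exact hZ.isUnit_coeIdeal (num_eq_zero_iff.not.2 hI) (IsNoetherian.noetherian _)

end IsPruferDomain

lemma det_updateRow_updateRow_one {R ι : Type*} [CommRing R] [Fintype ι] [DecidableEq ι]
    {p q : ι} (hpq : p ≠ q) (r s : ι → R) :
    (((1 : Matrix ι ι R).updateRow p r).updateRow q s).det = r p * s q - r q * s p := by
  let U : Matrix ι (Fin 2) R :=
    Matrix.of fun i => ![(Pi.single p 1 : ι → R) i, (Pi.single q 1 : ι → R) i]
  let V : Matrix (Fin 2) ι R := Matrix.of ![r - Pi.single p 1, s - Pi.single q 1]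
  have hUV : ((1 : Matrix ι ι R).updateRow p r).updateRow q s = 1 + U * V := by
    ext i k
    simp only [Matrix.updateRow_apply, Matrix.add_apply, Matrix.mul_apply, Fin.sum_univ_two, U, V]
    by_cases hi : i = p <;> by_cases hi' : i = q <;>
      simp_all [Matrix.one_apply, Pi.single_apply, eq_comm]
  have hVU : 1 + V * U = !![r p, r q; s p, s q] := by
    ext i k
    rw [Matrix.add_apply, Matrix.mul_apply]
    fin_cases i <;> fin_cases k <;> simp [U, V, Pi.single_apply, hpq, hpq.symm]
  rw [hUV, Matrix.det_one_add_mul_comm, hVU, Matrix.det_fin_two_of]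

lemma prod_update_eq_mul_div {M ι : Type*} [CommGroup M] [Fintype ι] [DecidableEq ι]
    (f : ι → M) (i : ι) (b : M) : ∏ j, Function.update f i b j = (∏ j, f j) * (b / f i) := by
  have hi := Finset.mem_univ i
  rw [Finset.prod_update_of_mem hi, ← Finset.mul_prod_erase _ f hi, Finset.sdiff_singleton_eq_erase]
  exact (mul_comm _ _).trans (by rw [mul_comm (f i), mul_assoc, mul_div_cancel])

namespace PseudoMatrix

variable {Z : Type*} [CommRing Z] {K : Type*} [Field K] [Algebra Z K] {l n m : ℕ}

section Invertible

variable {c : Fin l → (FractionalIdeal Z⁰ K)ˣ} {h h' h'' : Fin n → (FractionalIdeal Z⁰ K)ˣ}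
  {e e' e'' : Fin m → (FractionalIdeal Z⁰ K)ˣ}

@[simp]
lemma mul_mat (B : PseudoMatrix c h) (A : PseudoMatrix h e) : (B.mul A).mat = B.mat * A.mat :=
  rfl

@[simp]
lemma one_mat : (one h).mat = 1 :=
  rfl

lemma isInvertible_of_mul_mat_eq_one {A : PseudoMatrix h h'} (B : PseudoMatrix h' h)
    (hAB : A.mat * B.mat = 1) : A.IsInvertible :=
  ⟨B, PseudoMatrix.ext hAB, PseudoMatrix.ext (mul_eq_one_comm.1 hAB)⟩

lemma IsInvertible.exists_mul_mat_eq_one {A : PseudoMatrix h h'} (hA : A.IsInvertible) :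
    ∃ B : PseudoMatrix h' h, A.mat * B.mat = 1 ∧ B.mat * A.mat = 1 :=
  let ⟨B, hAB, hBA⟩ := hA
  ⟨B, congrArg mat hAB, congrArg mat hBA⟩

lemma isInvertible_one : (one h).IsInvertible :=
  isInvertible_of_mul_mat_eq_one (one h) (mul_one 1)

lemma IsInvertible.mul {A : PseudoMatrix h h'} {B : PseudoMatrix h' h''} (hA : A.IsInvertible)
    (hB : B.IsInvertible) : (A.mul B).IsInvertible := by
  obtain ⟨A', hA, -⟩ := hA.exists_mul_mat_eq_one
  obtain ⟨B', hB, -⟩ := hB.exists_mul_mat_eq_one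
  refine isInvertible_of_mul_mat_eq_one (B'.mul A') ?_
  rw [mul_mat, mul_mat, Matrix.mul_assoc, ← Matrix.mul_assoc B.mat, hB, Matrix.one_mul, hA]

lemma IsInvertible.equivalent_mul {L : PseudoMatrix h' h} (hL : L.IsInvertible)
    (A : PseudoMatrix h e) : A.Equivalent (L.mul A) :=
  ⟨L, one e, hL, isInvertible_one, PseudoMatrix.ext (Matrix.mul_one _)⟩

lemma Equivalent.refl (A : PseudoMatrix h e) : A.Equivalent A :=
  ⟨one h, one e, isInvertible_one, isInvertible_one, PseudoMatrix.ext (by simp)⟩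

lemma Equivalent.trans {A : PseudoMatrix h e} {A' : PseudoMatrix h' e'}
    {A'' : PseudoMatrix h'' e''} (hA : A.Equivalent A') (hA' : A'.Equivalent A'') :
    A.Equivalent A'' := by
  obtain ⟨L, C, hL, hC, rfl⟩ := hA
  obtain ⟨L', C', hL', hC', rfl⟩ := hA'
  exact ⟨L'.mul L, C.mul C', hL'.mul hL, hC.mul hC',
    PseudoMatrix.ext (by simp only [mul_mat, Matrix.mul_assoc])⟩

end Invertible

section MinorIdeal

variable [IsFractionRing Z K] {c : Fin l → (FractionalIdeal Z⁰ K)ˣ}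
  {h h' : Fin n → (FractionalIdeal Z⁰ K)ˣ} {e e' : Fin m → (FractionalIdeal Z⁰ K)ˣ}

lemma spanSingleton_mul_le (A : PseudoMatrix h e) (i : Fin n) (j : Fin m) :
    spanSingleton Z⁰ (A.mat i j) * e j ≤ (h i : FractionalIdeal Z⁰ K) :=
  spanSingleton_mul_le_iff.2 (A.mul_mem i j)

lemma minorIdeal_le_iff (A : PseudoMatrix h e) (i : Fin n) (j : Fin m)
    {I : FractionalIdeal Z⁰ K} :
    A.minorIdeal i j ≤ I ↔ spanSingleton Z⁰ (A.mat i j) * e j ≤ I * h i :=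
  Units.mul_inv_le_iff _

lemma minorIdeal_mul (A : PseudoMatrix h e) (i : Fin n) (j : Fin m) :
    A.minorIdeal i j * h i = spanSingleton Z⁰ (A.mat i j) * e j :=
  Units.inv_mul_cancel_right _ _

lemma minorIdeal_le_one (A : PseudoMatrix h e) (i : Fin n) (j : Fin m) : A.minorIdeal i j ≤ 1 :=
  (A.minorIdeal_le_iff i j).2 ((A.spanSingleton_mul_le i j).trans_eq (one_mul _).symm)

lemma minorIdeal_eq_zero_iff (A : PseudoMatrix h e) (i : Fin n) (j : Fin m) :
    A.minorIdeal i j = 0 ↔ A.mat i j = 0 := by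
  rw [minorIdeal, Units.mul_left_eq_zero, Units.mul_left_eq_zero, spanSingleton_eq_zero_iff]

lemma minorIdeal_mul_le {B : PseudoMatrix c h} {A : PseudoMatrix h e} {i : Fin l} {j : Fin m}
    {I : FractionalIdeal Z⁰ K} (hI : ∀ k, B.minorIdeal i k * A.minorIdeal k j ≤ I) :
    (B.mul A).minorIdeal i j ≤ I := by
  refine (minorIdeal_le_iff _ i j).2 ?_
  rw [mul_mat, Matrix.mul_apply]
  refine spanSingleton_sum_mul_le _ _ fun k _ => ?_
  calc spanSingleton Z⁰ (B.mat i k * A.mat k j) * e j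
      = spanSingleton Z⁰ (B.mat i k) * (spanSingleton Z⁰ (A.mat k j) * e j) := by
        rw [← spanSingleton_mul_spanSingleton, mul_assoc]
    _ = B.minorIdeal i k * A.minorIdeal k j * c i := by
        rw [← A.minorIdeal_mul, mul_left_comm, ← B.minorIdeal_mul, mul_left_comm, mul_assoc]
    _ ≤ I * c i := by gcongr; exact hI k

lemma Equivalent.minorIdeal_le {A : PseudoMatrix h e} {A' : PseudoMatrix h' e'}
    (hA : A.Equivalent A') {I : FractionalIdeal Z⁰ K} (hI : ∀ i j, A.minorIdeal i j ≤ I)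
    (i : Fin n) (j : Fin m) : A'.minorIdeal i j ≤ I := by
  obtain ⟨L, C, -, -, rfl⟩ := hA
  refine minorIdeal_mul_le fun k => mul_le_of_le_of_le_one (minorIdeal_mul_le fun i' => ?_)
    (C.minorIdeal_le_one k j)
  exact mul_le_of_le_one_of_le (L.minorIdeal_le_one i i') (hI i' k)

end MinorIdeal

section Transpose

variable [IsFractionRing Z K] {h h' : Fin n → (FractionalIdeal Z⁰ K)ˣ}
  {e e' : Fin m → (FractionalIdeal Z⁰ K)ˣ}

/-- The transpose `(e⁻¹; h⁻¹; Aᵀ)` of a pseudo-matrix `(h; e; A)`, through which statements about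
columns follow from statements about rows. The inverse ideals are those of the dual
pseudo-bases. -/
def transpose (A : PseudoMatrix h e) : PseudoMatrix e⁻¹ h⁻¹ where
  mat := A.mat.transpose
  mul_mem j i := by
    rw [← spanSingleton_mul_le_iff, Pi.inv_apply, Pi.inv_apply, Units.mul_inv_le_iff,
      Units.le_inv_mul_iff, mul_comm]
    exact A.spanSingleton_mul_le i j

@[simp]
lemma transpose_mat (A : PseudoMatrix h e) : A.transpose.mat = A.mat.transpose :=
  rfl

lemma minorIdeal_transpose (A : PseudoMatrix h e) (i : Fin n) (j : Fin m) :
    A.transpose.minorIdeal j i = A.minorIdeal i j := by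
  simp only [minorIdeal, transpose_mat, Matrix.transpose_apply, Pi.inv_apply, inv_inv,
    mul_right_comm]

lemma IsInvertible.transpose {h h' : Fin n → (FractionalIdeal Z⁰ K)ˣ} {L : PseudoMatrix h h'}
    (hL : L.IsInvertible) : L.transpose.IsInvertible := by
  obtain ⟨B, -, hBL⟩ := hL.exists_mul_mat_eq_one
  refine isInvertible_of_mul_mat_eq_one B.transpose ?_
  rw [transpose_mat, transpose_mat, ← Matrix.transpose_mul, hBL, Matrix.transpose_one]

lemma Equivalent.transpose {A : PseudoMatrix h e} {A' : PseudoMatrix h' e'}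
    (hA : A.Equivalent A') : A.transpose.Equivalent A'.transpose := by
  obtain ⟨L, C, hL, hC, rfl⟩ := hA
  exact ⟨C.transpose, L.transpose, hC.transpose, hL.transpose, PseudoMatrix.ext
    (by simp only [mul_mat, transpose_mat, Matrix.transpose_mul, Matrix.mul_assoc])⟩

end Transpose

section UpdateRow

variable [IsFractionRing Z K] {h : Fin n → (FractionalIdeal Z⁰ K)ˣ}
  {e : Fin m → (FractionalIdeal Z⁰ K)ˣ}

/-- The pseudo-matrix obtained by replacing the `i`-th row by `r` and the ideal in front of it
by `a`. -/
def updateRow (A : PseudoMatrix h e) (i : Fin n) (a : (FractionalIdeal Z⁰ K)ˣ) (r : Fin m → K)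
    (hr : ∀ j, spanSingleton Z⁰ (r j) * e j ≤ (a : FractionalIdeal Z⁰ K)) :
    PseudoMatrix (Function.update h i a) e where
  mat := A.mat.updateRow i r
  mul_mem k j := by
    rw [← spanSingleton_mul_le_iff]
    rcases eq_or_ne k i with rfl | hk
    · simpa using hr j
    · simpa [hk] using A.spanSingleton_mul_le k j

@[simp]
lemma updateRow_mat (A : PseudoMatrix h e) (i : Fin n) (a : (FractionalIdeal Z⁰ K)ˣ)
    (r : Fin m → K) (hr : ∀ j, spanSingleton Z⁰ (r j) * e j ≤ (a : FractionalIdeal Z⁰ K)) :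
    (A.updateRow i a r hr).mat = A.mat.updateRow i r :=
  rfl

lemma spanSingleton_single_mul_le {i : Fin m} {x : K} {a : FractionalIdeal Z⁰ K}
    (hx : spanSingleton Z⁰ x * e i ≤ a) (j : Fin m) :
    spanSingleton Z⁰ ((Pi.single i x : Fin m → K) j) * e j ≤ a := by
  rcases eq_or_ne j i with rfl | hj
  · simpa using hx
  · simp [hj]

lemma spanSingleton_single_add_single_mul_le {i k : Fin m} {x y : K} {a : FractionalIdeal Z⁰ K}
    (hx : spanSingleton Z⁰ x * e i ≤ a) (hy : spanSingleton Z⁰ y * e k ≤ a) (j : Fin m) :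
    spanSingleton Z⁰ ((Pi.single i x + Pi.single k y : Fin m → K) j) * e j ≤ a :=
  spanSingleton_add_mul_le (spanSingleton_single_mul_le hx j) (spanSingleton_single_mul_le hy j)

end UpdateRow

section Determinant

variable [IsFractionRing Z K] {h e : Fin n → (FractionalIdeal Z⁰ K)ˣ}

lemma spanSingleton_det_mul_prod_le (A : PseudoMatrix h e) :
    spanSingleton Z⁰ A.mat.det * (∏ i, e i : (FractionalIdeal Z⁰ K)ˣ) ≤
      (∏ i, h i : (FractionalIdeal Z⁰ K)ˣ) := by
  rw [Matrix.det_apply']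
  refine spanSingleton_sum_mul_le _ _ fun σ _ => ?_
  have hsign : spanSingleton Z⁰ ((Equiv.Perm.sign σ : ℤ) : K) ≤ 1 :=
    spanSingleton_le_iff_mem.2 ((mem_one_iff _).2 ⟨(Equiv.Perm.sign σ : ℤ), map_intCast _ _⟩)
  rw [← spanSingleton_mul_spanSingleton, mul_assoc, spanSingleton_prod, ← Equiv.prod_comp σ h,
    Units.coe_prod, Units.coe_prod, ← Finset.prod_mul_distrib]
  refine mul_le_of_le_one_of_le hsign ?_
  exact Finset.prod_le_prod (fun i _ => zero_le _) fun i _ => A.spanSingleton_mul_le (σ i) i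

lemma spanSingleton_adjugate_mul_le (A : PseudoMatrix h e) (i j : Fin n) :
    spanSingleton Z⁰ (A.mat.adjugate i j) * (∏ k, e k : (FractionalIdeal Z⁰ K)ˣ) ≤
      ((∏ k, h k) * (e i / h j) : (FractionalIdeal Z⁰ K)ˣ) := by
  rw [Matrix.adjugate_apply, ← prod_update_eq_mul_div]
  exact (A.updateRow j (e i) (Pi.single i 1)
    (spanSingleton_single_mul_le (by simp))).spanSingleton_det_mul_prod_le

lemma isInvertible_of_spanSingleton_det_mul_prod_eq {A : PseudoMatrix h e}
    (hA : spanSingleton Z⁰ A.mat.det * (∏ i, e i : (FractionalIdeal Z⁰ K)ˣ) =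
      (∏ i, h i : (FractionalIdeal Z⁰ K)ˣ)) : A.IsInvertible := by
  have hdet : A.mat.det ≠ 0 := by
    intro h0
    rw [h0, spanSingleton_zero, zero_mul] at hA
    exact Units.ne_zero _ hA.symm
  have hle : ∀ i j, spanSingleton Z⁰ (A.mat.det⁻¹ * A.mat.adjugate i j) ≤
      (e i / h j : (FractionalIdeal Z⁰ K)ˣ) := by
    refine fun i j => Units.mulLECancellable_val (∏ k, h k) ?_
    calc (∏ k, h k : (FractionalIdeal Z⁰ K)ˣ) *
          spanSingleton Z⁰ (A.mat.det⁻¹ * A.mat.adjugate i j)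
        = spanSingleton Z⁰ (A.mat.adjugate i j) * (∏ k, e k : (FractionalIdeal Z⁰ K)ˣ) *
            spanSingleton Z⁰ (A.mat.det⁻¹ * A.mat.det) := by
          rw [← hA, ← spanSingleton_mul_spanSingleton, ← spanSingleton_mul_spanSingleton]
          ring
      _ = spanSingleton Z⁰ (A.mat.adjugate i j) * (∏ k, e k : (FractionalIdeal Z⁰ K)ˣ) := by
          rw [inv_mul_cancel₀ hdet, spanSingleton_one, mul_one]
      _ ≤ _ := A.spanSingleton_adjugate_mul_le i j
  let B : PseudoMatrix e h :=
    { mat := A.mat.det⁻¹ • A.mat.adjugate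
      mul_mem := fun i j => spanSingleton_mul_le_iff.1 <| by
        rw [Matrix.smul_apply, smul_eq_mul, ← Units.le_mul_inv_iff, ← Units.val_mul,
          ← div_eq_mul_inv]
        exact hle i j }
  refine isInvertible_of_mul_mat_eq_one B ?_
  rw [Matrix.mul_smul, Matrix.mul_adjugate, inv_smul_smul₀ hdet]

end Determinant
section RowOperations

variable [IsFractionRing Z K] {h : Fin n → (FractionalIdeal Z⁰ K)ˣ}
  {e : Fin m → (FractionalIdeal Z⁰ K)ˣ}

lemma exists_equivalent_add_row (A : PseudoMatrix h e) {p : Fin n} {c : Fin n → K} (hcp : c p = 0)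
    (hc : ∀ i, spanSingleton Z⁰ (c i) * h p ≤ h i) :
    ∃ A' : PseudoMatrix h e, A.Equivalent A' ∧
      ∀ i j, A'.mat i j = A.mat i j + c i * A.mat p j := by
  let L : PseudoMatrix h h :=
    { mat := 1 + Matrix.vecMulVec c (Pi.single p 1)
      mul_mem := fun i k => spanSingleton_mul_le_iff.1 <| by
        refine spanSingleton_add_mul_le ((one h).spanSingleton_mul_le i k) ?_
        rcases eq_or_ne k p with rfl | hk
        · simpa [Matrix.vecMulVec_apply] using hc i
        · simp [Matrix.vecMulVec_apply, hk] }
  have hdet : L.mat.det = 1 := by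
    simp [L, Matrix.vecMulVec_eq Unit, Matrix.det_one_add_replicateCol_mul_replicateRow, hcp]
  have hL : L.IsInvertible := isInvertible_of_spanSingleton_det_mul_prod_eq (by simp [hdet])
  refine ⟨L.mul A, hL.equivalent_mul A, fun i j => ?_⟩
  simp [L, add_mul, Matrix.mul_apply, Matrix.one_apply, Matrix.vecMulVec_apply,
    Finset.sum_add_distrib, Pi.single_apply]

lemma spanSingleton_div_mul_le_of_minorIdeal_le (A : PseudoMatrix h e) {i p : Fin n} {q : Fin m}
    (hA : A.minorIdeal i q ≤ A.minorIdeal p q) :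
    spanSingleton Z⁰ (A.mat i q / A.mat p q) * h p ≤ (h i : FractionalIdeal Z⁰ K) := by
  rcases eq_or_ne (A.mat p q) 0 with hpq | hpq
  · simp [hpq]
  have hle : spanSingleton Z⁰ (A.mat i q) * h p ≤ spanSingleton Z⁰ (A.mat p q) * h i := by
    refine Units.mulLECancellable_val (e q) ?_
    calc (e q : FractionalIdeal Z⁰ K) * (spanSingleton Z⁰ (A.mat i q) * h p)
        = A.minorIdeal i q * (h i * h p) := by
          rw [← mul_assoc, mul_comm (e q : FractionalIdeal Z⁰ K), ← minorIdeal_mul, mul_assoc]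
      _ ≤ A.minorIdeal p q * (h i * h p) := by gcongr
      _ = e q * (spanSingleton Z⁰ (A.mat p q) * h i) := by
          rw [mul_comm (h i : FractionalIdeal Z⁰ K), ← mul_assoc, minorIdeal_mul]
          ring
  calc spanSingleton Z⁰ (A.mat i q / A.mat p q) * h p
      = spanSingleton Z⁰ (A.mat p q)⁻¹ * (spanSingleton Z⁰ (A.mat i q) * h p) := by
        rw [div_eq_inv_mul, ← spanSingleton_mul_spanSingleton, mul_assoc]
    _ ≤ spanSingleton Z⁰ (A.mat p q)⁻¹ * (spanSingleton Z⁰ (A.mat p q) * h i) := by gcongr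
    _ = h i := by
        rw [← mul_assoc, spanSingleton_mul_spanSingleton, inv_mul_cancel₀ hpq, spanSingleton_one,
          one_mul]

lemma exists_equivalent_clear_col (A : PseudoMatrix h e) {p : Fin n} {q : Fin m}
    (hA : ∀ i, A.minorIdeal i q ≤ A.minorIdeal p q) :
    ∃ A' : PseudoMatrix h e, A.Equivalent A' ∧ (∀ j, A'.mat p j = A.mat p j) ∧
      ∀ i ≠ p, A'.mat i q = 0 := by
  let c : Fin n → K := Function.update (fun i => -(A.mat i q / A.mat p q)) p 0
  have hc : ∀ i, spanSingleton Z⁰ (c i) * h p ≤ (h i : FractionalIdeal Z⁰ K) := by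
    intro i
    rcases eq_or_ne i p with rfl | hi
    · simp [c]
    · simpa [c, hi, spanSingleton_neg] using A.spanSingleton_div_mul_le_of_minorIdeal_le (hA i)
  have hzero : A.mat p q = 0 → ∀ i, A.mat i q = 0 := fun hpq i => by
    rw [← minorIdeal_eq_zero_iff, ← FractionalIdeal.le_zero_iff] at hpq ⊢
    exact (hA i).trans hpq
  obtain ⟨A', hAA', hA'⟩ := A.exists_equivalent_add_row (Function.update_self p 0 _) hc
  refine ⟨A', hAA', fun j => by simp [hA'], fun i hi => ?_⟩
  simp [hA', hi, div_mul_cancel_of_imp fun hpq => hzero hpq i]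

lemma exists_equivalent_combine_rows (A : PseudoMatrix h e) {p q : Fin n} (hpq : p ≠ q)
    {g k : (FractionalIdeal Z⁰ K)ˣ} (hgk : g * k = h p * h q) {r s t u : K}
    (hr : spanSingleton Z⁰ r * h p ≤ (g : FractionalIdeal Z⁰ K))
    (hs : spanSingleton Z⁰ s * h q ≤ (g : FractionalIdeal Z⁰ K))
    (ht : spanSingleton Z⁰ t * h p ≤ (k : FractionalIdeal Z⁰ K))
    (hu : spanSingleton Z⁰ u * h q ≤ (k : FractionalIdeal Z⁰ K)) (hdet : r * u - s * t = 1) :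
    ∃ (h' : Fin n → (FractionalIdeal Z⁰ K)ˣ) (A' : PseudoMatrix h' e), A.Equivalent A' ∧
      h' p = g ∧ ∀ j, A'.mat p j = r * A.mat p j + s * A.mat q j := by
  let L := ((one h).updateRow p g _ (spanSingleton_single_add_single_mul_le hr hs)).updateRow q k
    _ (spanSingleton_single_add_single_mul_le ht hu)
  have hLdet : L.mat.det = 1 := by
    simp only [L, updateRow_mat, one_mat, det_updateRow_updateRow_one hpq]
    simpa [hpq, hpq.symm] using hdet
  have hprod : ∏ i, Function.update (Function.update h p g) q k i = ∏ i, h i := by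
    rw [prod_update_eq_mul_div, prod_update_eq_mul_div, Function.update_of_ne hpq.symm, mul_assoc,
      div_mul_div_comm, hgk, div_self', mul_one]
  have hL : L.IsInvertible :=
    isInvertible_of_spanSingleton_det_mul_prod_eq
      (by rw [hLdet, spanSingleton_one, one_mul, hprod])
  have hLA : ∀ j, (L.mul A).mat p j = r * A.mat p j + s * A.mat q j := fun j => by
    simp [L, Matrix.mul_apply, Matrix.updateRow_ne hpq, add_mul, Finset.sum_add_distrib,
      Pi.single_apply]
  exact ⟨_, L.mul A, hL.equivalent_mul A, by simp [hpq], hLA⟩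

lemma exists_equivalent_minorIdeal_eq_add (A : PseudoMatrix h e) {p q : Fin n} (hpq : p ≠ q)
    {j : Fin m} {γ : (FractionalIdeal Z⁰ K)ˣ}
    (hγ : A.minorIdeal p j + A.minorIdeal q j = γ) :
    ∃ (h' : Fin n → (FractionalIdeal Z⁰ K)ˣ) (A' : PseudoMatrix h' e),
      A.Equivalent A' ∧ A'.minorIdeal p j = γ := by
  let g := e j * γ⁻¹
  let k := γ * (e j)⁻¹ * (h p * h q)
  have hone : spanSingleton Z⁰ (A.mat p j) * (g * ((h p)⁻¹ : (FractionalIdeal Z⁰ K)ˣ)) +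
      spanSingleton Z⁰ (A.mat q j) * (g * ((h q)⁻¹ : (FractionalIdeal Z⁰ K)ˣ)) = 1 := by
    rw [← Units.mul_inv γ, ← hγ]
    simp only [minorIdeal, g, Units.val_mul]
    ring
  obtain ⟨r, hr, s, hs, hrs⟩ := exists_mul_add_mul_eq_one hone
  rw [← spanSingleton_mul_units_le_iff] at hr hs
  have hk : ∀ i, A.minorIdeal i j ≤ γ → ∀ i', spanSingleton Z⁰ (A.mat i j) * h i' ≤
      (γ * (e j)⁻¹ * (h i' * h i) : (FractionalIdeal Z⁰ K)ˣ) := by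
    intro i hi i'
    rw [minorIdeal_le_iff, ← Units.le_mul_inv_iff] at hi
    calc spanSingleton Z⁰ (A.mat i j) * h i'
        ≤ γ * h i * ((e j)⁻¹ : (FractionalIdeal Z⁰ K)ˣ) * h i' := by gcongr
      _ = (γ * (e j)⁻¹ * (h i' * h i) : (FractionalIdeal Z⁰ K)ˣ) := by
          simp only [Units.val_mul]
          ring
  have hp : spanSingleton Z⁰ (A.mat p j) * h q ≤ (k : FractionalIdeal Z⁰ K) := by
    simpa only [k, mul_comm (h p)] using hk p (hγ ▸ le_self_add) q
  have hq : spanSingleton Z⁰ (-A.mat q j) * h p ≤ (k : FractionalIdeal Z⁰ K) := by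
    rw [spanSingleton_neg]
    exact hk q (hγ ▸ le_add_self) p
  obtain ⟨h', A', hAA', hg, hA'⟩ := A.exists_equivalent_combine_rows hpq
    (show g * k = h p * h q by simp only [g, k]; group) hr hs hq hp
    (by linear_combination hrs)
  refine ⟨h', A', hAA', ?_⟩
  rw [minorIdeal, hA', hg, mul_comm r, mul_comm s, hrs, spanSingleton_one, one_mul, ← Units.val_mul]
  simp [g]

end RowOperations

section Maximal

variable [IsFractionRing Z K] {h h' : Fin n → (FractionalIdeal Z⁰ K)ˣ}
  {e e' : Fin m → (FractionalIdeal Z⁰ K)ˣ} {p : Fin n} {q : Fin m}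

/-- No pseudo-matrix equivalent to `A` has a strictly larger minor ideal at `(p, q)`. -/
def IsMaximalAt (A : PseudoMatrix h e) (p : Fin n) (q : Fin m) : Prop :=
  ∀ ⦃h' : Fin n → (FractionalIdeal Z⁰ K)ˣ⦄ ⦃e' : Fin m → (FractionalIdeal Z⁰ K)ˣ⦄
    (A' : PseudoMatrix h' e'), A.Equivalent A' →
      A.minorIdeal p q ≤ A'.minorIdeal p q → A'.minorIdeal p q ≤ A.minorIdeal p q

/-- The entry at `(p, q)` is the only one in its row and its column that may be nonzero. -/
def IsSplitAt (A : PseudoMatrix h e) (p : Fin n) (q : Fin m) : Prop :=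
  (∀ i ≠ p, A.mat i q = 0) ∧ ∀ j ≠ q, A.mat p j = 0

lemma exists_equivalent_isMaximalAt [IsNoetherianRing Z] (A : PseudoMatrix h e) (p : Fin n)
    (q : Fin m) :
    ∃ (h' : Fin n → (FractionalIdeal Z⁰ K)ˣ) (e' : Fin m → (FractionalIdeal Z⁰ K)ˣ)
      (A' : PseudoMatrix h' e'), A.Equivalent A' ∧ A'.IsMaximalAt p q := by
  obtain ⟨J₀, hJ₀⟩ := le_one_iff_exists_coeIdeal.1 (A.minorIdeal_le_one p q)
  obtain ⟨J, ⟨h', e', A', hAA', hJ⟩, hmax⟩ := exists_maximal_of_wellFoundedGT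
    (fun J : Ideal Z => ∃ (h' : Fin n → (FractionalIdeal Z⁰ K)ˣ)
      (e' : Fin m → (FractionalIdeal Z⁰ K)ˣ) (A' : PseudoMatrix h' e'),
      A.Equivalent A' ∧ (J : FractionalIdeal Z⁰ K) = A'.minorIdeal p q)
    ⟨J₀, h, e, A, Equivalent.refl A, hJ₀⟩
  refine ⟨h', e', A', hAA', fun h'' e'' A'' hA'' hle => ?_⟩
  obtain ⟨J', hJ'⟩ := le_one_iff_exists_coeIdeal.1 (A''.minorIdeal_le_one p q)
  rw [← hJ, ← hJ', coeIdeal_le_coeIdeal] at hle ⊢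
  exact hmax ⟨h'', e'', A'', hAA'.trans hA'', hJ'⟩ hle

namespace IsMaximalAt

lemma of_equivalent {A : PseudoMatrix h e} {A' : PseudoMatrix h' e'} (hA : A.IsMaximalAt p q)
    (hAA' : A.Equivalent A') (hminor : A'.minorIdeal p q = A.minorIdeal p q) :
    A'.IsMaximalAt p q := by
  intro h'' e'' A'' hA''
  rw [hminor]
  exact hA A'' (hAA'.trans hA'')

lemma transpose {A : PseudoMatrix h e} (hA : A.IsMaximalAt p q) :
    A.transpose.IsMaximalAt q p := by
  intro e' h' A' hAA'
  rw [minorIdeal_transpose, ← minorIdeal_transpose A']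
  exact hA A'.transpose hAA'.transpose

variable [IsDedekindDomain Z] {A : PseudoMatrix h e}

lemma minorIdeal_col_le (hA : A.IsMaximalAt p q) (i : Fin n) :
    A.minorIdeal i q ≤ A.minorIdeal p q := by
  rcases eq_or_ne p i with rfl | hpi
  · exact le_rfl
  rcases eq_or_ne (A.minorIdeal p q + A.minorIdeal i q) 0 with hsum | hsum
  · exact le_add_self.trans (hsum.le.trans (zero_le _))
  obtain ⟨h', A', hAA', hA'⟩ :=
    A.exists_equivalent_minorIdeal_eq_add hpi (IsUnit.mk0 _ hsum).unit_spec.symm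
  rw [IsUnit.unit_spec] at hA'
  exact le_add_self.trans (hA' ▸ hA A' hAA' (hA' ▸ le_self_add))

lemma minorIdeal_row_le (hA : A.IsMaximalAt p q) (j : Fin m) :
    A.minorIdeal p j ≤ A.minorIdeal p q := by
  simpa only [minorIdeal_transpose] using hA.transpose.minorIdeal_col_le j

lemma exists_equivalent_clear_col (hA : A.IsMaximalAt p q) :
    ∃ A' : PseudoMatrix h e, A.Equivalent A' ∧ A'.IsMaximalAt p q ∧
      (∀ j, A'.mat p j = A.mat p j) ∧ ∀ i ≠ p, A'.mat i q = 0 := by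
  obtain ⟨A', hAA', hrow, hcol⟩ := A.exists_equivalent_clear_col hA.minorIdeal_col_le
  exact ⟨A', hAA', hA.of_equivalent hAA' (by rw [minorIdeal, minorIdeal, hrow]), hrow, hcol⟩

lemma exists_equivalent_isSplitAt (hA : A.IsMaximalAt p q) :
    ∃ A' : PseudoMatrix h e, A.Equivalent A' ∧ A'.IsMaximalAt p q ∧ A'.IsSplitAt p q := by
  obtain ⟨A₁, hAA₁, hA₁, -, hcol⟩ := hA.exists_equivalent_clear_col
  obtain ⟨A₂, hA₁₂, hA₂, hrow, hcol'⟩ := hA₁.transpose.exists_equivalent_clear_col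
  exact ⟨A₂.transpose, hAA₁.trans hA₁₂.transpose, hA₂.transpose,
    fun i hi => (hrow i).trans (hcol i hi), hcol'⟩

lemma minorIdeal_le (hA : A.IsMaximalAt p q) (hsplit : A.IsSplitAt p q) (i : Fin n) (j : Fin m) :
    A.minorIdeal i j ≤ A.minorIdeal p q := by
  rcases eq_or_ne i p with rfl | hi
  · exact hA.minorIdeal_row_le j
  rcases eq_or_ne j q with rfl | hj
  · exact hA.minorIdeal_col_le i
  have hadd : ∀ t ∈ (h p * ((h i)⁻¹ : (FractionalIdeal Z⁰ K)ˣ) : FractionalIdeal Z⁰ K),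
      spanSingleton Z⁰ t * (spanSingleton Z⁰ (A.mat i j) * e j) ≤ A.minorIdeal p q * h p := by
    intro t ht
    have hc : ∀ k, spanSingleton Z⁰ ((Pi.single p t : Fin n → K) k) * h i ≤
        (h k : FractionalIdeal Z⁰ K) := by
      intro k
      rcases eq_or_ne k p with rfl | hk
      · simpa using spanSingleton_mul_units_le_iff.2 ht
      · simp [hk]
    obtain ⟨A', hAA', hA'⟩ := A.exists_equivalent_add_row (Pi.single_eq_of_ne hi t) hc
    have hpq : A'.minorIdeal p q = A.minorIdeal p q := by
      rw [minorIdeal, minorIdeal, hA', hsplit.1 i hi, mul_zero, add_zero]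
    have hpj := ((hA.of_equivalent hAA' hpq).minorIdeal_row_le j).trans_eq hpq
    rwa [minorIdeal_le_iff, hA', hsplit.2 j hj, zero_add, Pi.single_eq_same,
      ← spanSingleton_mul_spanSingleton, mul_assoc] at hpj
  refine Units.mulLECancellable_val (h p) ?_
  calc (h p : FractionalIdeal Z⁰ K) * A.minorIdeal i j
      = h p * ((h i)⁻¹ : (FractionalIdeal Z⁰ K)ˣ) * (spanSingleton Z⁰ (A.mat i j) * e j) := by
        rw [minorIdeal]
        ring
    _ ≤ A.minorIdeal p q * h p :=
        mul_le.2 fun t ht y hy => spanSingleton_mul_le_iff.1 (hadd t ht) y hy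
    _ = h p * A.minorIdeal p q := mul_comm _ _

end IsMaximalAt

lemma exists_equivalent_isSplitAt [IsDedekindDomain Z] (A : PseudoMatrix h e) (p : Fin n)
    (q : Fin m) :
    ∃ (h' : Fin n → (FractionalIdeal Z⁰ K)ˣ) (e' : Fin m → (FractionalIdeal Z⁰ K)ˣ)
      (A' : PseudoMatrix h' e'), A.Equivalent A' ∧ A'.IsSplitAt p q ∧
        ∀ i j, A'.minorIdeal i j ≤ A'.minorIdeal p q := by
  obtain ⟨h', e', A₁, hAA₁, hA₁⟩ := A.exists_equivalent_isMaximalAt p q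
  obtain ⟨A₂, hA₁₂, hA₂, hsplit⟩ := hA₁.exists_equivalent_isSplitAt
  exact ⟨h', e', A₂, hAA₁.trans hA₁₂, hsplit, hA₂.minorIdeal_le hsplit⟩

end Maximal

section DiagCons

variable [IsFractionRing Z K] {h h' : Fin n → (FractionalIdeal Z⁰ K)ˣ}
  {e e' : Fin m → (FractionalIdeal Z⁰ K)ˣ} {u v w : (FractionalIdeal Z⁰ K)ˣ} {a b c : K}

/-- The block diagonal pseudo-matrix with blocks `(u; v; a)` and `A`. -/
def diagCons (a : K) (ha : spanSingleton Z⁰ a * v ≤ (u : FractionalIdeal Z⁰ K))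
    (A : PseudoMatrix h e) : PseudoMatrix (Matrix.vecCons u h) (Matrix.vecCons v e) where
  mat := Matrix.of (Matrix.vecCons (Matrix.vecCons a 0) fun i => Matrix.vecCons 0 (A.mat i))
  mul_mem i j := spanSingleton_mul_le_iff.1 <| by
    cases i using Fin.cases <;> cases j using Fin.cases
    · simpa using ha
    · simp
    · simp
    · simpa using A.spanSingleton_mul_le _ _

@[simp]
lemma diagCons_mat (ha : spanSingleton Z⁰ a * v ≤ (u : FractionalIdeal Z⁰ K))
    (A : PseudoMatrix h e) : (A.diagCons a ha).mat =
      Matrix.of (Matrix.vecCons (Matrix.vecCons a 0) fun i => Matrix.vecCons 0 (A.mat i)) :=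
  rfl

/-- The pseudo-matrix obtained by deleting the first row and the first column. -/
def tail (A : PseudoMatrix (Matrix.vecCons u h) (Matrix.vecCons v e)) : PseudoMatrix h e where
  mat := A.mat.submatrix Fin.succ Fin.succ
  mul_mem i j := A.mul_mem i.succ j.succ

lemma IsSplitAt.eq_diagCons_tail {A : PseudoMatrix (Matrix.vecCons u h) (Matrix.vecCons v e)}
    (hA : A.IsSplitAt 0 0) :
    A = A.tail.diagCons (A.mat 0 0) (A.spanSingleton_mul_le 0 0) := by
  ext i j
  cases i using Fin.cases <;> cases j using Fin.cases
  · rfl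
  · exact hA.2 _ (Fin.succ_ne_zero _)
  · exact hA.1 _ (Fin.succ_ne_zero _)
  · rfl

lemma one_eq_diagCons : one (Matrix.vecCons u h) = (one h).diagCons 1 (by simp) := by
  ext i j
  cases i using Fin.cases <;> cases j using Fin.cases <;> simp [Matrix.one_apply, Fin.ext_iff]

lemma diagCons_mul_diagCons {k : Fin l → (FractionalIdeal Z⁰ K)ˣ} (B : PseudoMatrix k h)
    (A : PseudoMatrix h e) (hba : b * a = c)
    (hb : spanSingleton Z⁰ b * u ≤ (w : FractionalIdeal Z⁰ K))
    (ha : spanSingleton Z⁰ a * v ≤ (u : FractionalIdeal Z⁰ K))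
    (hc : spanSingleton Z⁰ c * v ≤ (w : FractionalIdeal Z⁰ K)) :
    (B.diagCons b hb).mul (A.diagCons a ha) = (B.mul A).diagCons c hc := by
  ext i j
  cases i using Fin.cases <;> cases j using Fin.cases <;>
    simp [Matrix.mul_apply, Fin.sum_univ_succ, hba]

lemma IsInvertible.diagCons_one {h h' : Fin n → (FractionalIdeal Z⁰ K)ˣ} {L : PseudoMatrix h h'}
    (hL : L.IsInvertible) (hu : spanSingleton Z⁰ (1 : K) * u ≤ (u : FractionalIdeal Z⁰ K)) :
    (L.diagCons 1 hu).IsInvertible := by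
  obtain ⟨B, hLB, hBL⟩ := hL
  refine ⟨B.diagCons 1 hu, ?_, ?_⟩
  · rw [one_eq_diagCons, ← hLB]
    exact diagCons_mul_diagCons L B (mul_one 1) hu hu _
  · rw [one_eq_diagCons, ← hBL]
    exact diagCons_mul_diagCons B L (mul_one 1) hu hu _

lemma Equivalent.diagCons {A : PseudoMatrix h e} {A' : PseudoMatrix h' e'}
    (hA : A.Equivalent A') (ha : spanSingleton Z⁰ a * v ≤ (u : FractionalIdeal Z⁰ K)) :
    (A.diagCons a ha).Equivalent (A'.diagCons a ha) := by
  obtain ⟨L, C, hL, hC, rfl⟩ := hA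
  refine ⟨_, _, hL.diagCons_one (by simp), hC.diagCons_one (by simp), ?_⟩
  rw [diagCons_mul_diagCons L A (one_mul a) _ ha ha,
    diagCons_mul_diagCons _ C (mul_one a) ha _ ha]

lemma isSmith_iff {A : PseudoMatrix h e} :
    A.IsSmith ↔ (∀ (i : Fin n) (j : Fin m), (i : ℕ) ≠ j → A.mat i j = 0) ∧
      ∀ (i k : Fin n) (j l : Fin m), (i : ℕ) = j → (k : ℕ) = l → i ≤ k →
        A.minorIdeal k l ≤ A.minorIdeal i j := by
  refine and_congr_right fun _ => ⟨fun hA i k j l hij hkl hik => ?_, fun hA i k hik => ?_⟩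
  · convert hA (a := ⟨i, lt_min i.2 (hij ▸ j.2)⟩) (b := ⟨k, lt_min k.2 (hkl ▸ l.2)⟩) hik using 2
    · exact Fin.ext rfl
    · exact Fin.ext hkl.symm
    · exact Fin.ext rfl
    · exact Fin.ext hij.symm
  · exact hA _ _ _ _ rfl rfl hik

lemma eq_zero_or_exists_succ_of_val_eq {i : Fin (n + 1)} {j : Fin (m + 1)} (hij : (i : ℕ) = j) :
    i = 0 ∧ j = 0 ∨ ∃ i', i = Fin.succ i' ∧ ∃ j', j = Fin.succ j' ∧ (i' : ℕ) = j' := by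
  cases i using Fin.cases with
  | zero => exact .inl ⟨rfl, Fin.ext hij.symm⟩
  | succ i =>
    cases j using Fin.cases with
    | zero => exact absurd hij i.val.succ_ne_zero
    | succ j => exact .inr ⟨i, rfl, j, rfl, Nat.succ.inj hij⟩

lemma IsSmith.diagCons {A : PseudoMatrix h e} (hA : A.IsSmith)
    (ha : spanSingleton Z⁰ a * v ≤ (u : FractionalIdeal Z⁰ K))
    (hle : ∀ i j, A.minorIdeal i j ≤ (A.diagCons a ha).minorIdeal 0 0) :
    (A.diagCons a ha).IsSmith := by
  rw [isSmith_iff] at hA ⊢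
  refine ⟨fun i j hij => ?_, fun i k j l hij hkl hik => ?_⟩
  · cases i using Fin.cases <;> cases j using Fin.cases
    · exact absurd rfl hij
    · rfl
    · rfl
    · exact hA.1 _ _ (by simpa using hij)
  · obtain ⟨rfl, rfl⟩ | ⟨k, rfl, l, rfl, hkl'⟩ := eq_zero_or_exists_succ_of_val_eq hkl
    · obtain rfl := Fin.le_zero_iff.1 hik
      obtain rfl : j = 0 := Fin.ext hij.symm
      exact le_rfl
    obtain ⟨rfl, rfl⟩ | ⟨i, rfl, j, rfl, hij'⟩ := eq_zero_or_exists_succ_of_val_eq hij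
    · exact hle k l
    · exact hA.2 i k j l hij' hkl' (Fin.succ_le_succ_iff.1 hik)

lemma exists_equivalent_isSmith [IsDedekindDomain Z] (A : PseudoMatrix h e) :
    ∃ (h' : Fin n → (FractionalIdeal Z⁰ K)ˣ) (e' : Fin m → (FractionalIdeal Z⁰ K)ˣ)
      (A' : PseudoMatrix h' e'), A.Equivalent A' ∧ A'.IsSmith := by
  induction n generalizing m with
  | zero => exact ⟨h, e, A, Equivalent.refl A, isSmith_iff.2 ⟨fun i => i.elim0, fun i => i.elim0⟩⟩
  | succ n ih =>
    rcases m with _ | m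
    · exact ⟨h, e, A, Equivalent.refl A,
        isSmith_iff.2 ⟨fun _ j => j.elim0, fun _ _ j => j.elim0⟩⟩
    obtain ⟨h₁, e₁, A₁, hAA₁, hsplit, hle⟩ := A.exists_equivalent_isSplitAt 0 0
    obtain ⟨u, h₁, rfl⟩ : ∃ u h₂, h₁ = Matrix.vecCons u h₂ :=
      ⟨_, _, (Matrix.cons_head_tail h₁).symm⟩
    obtain ⟨v, e₁, rfl⟩ : ∃ v e₂, e₁ = Matrix.vecCons v e₂ :=
      ⟨_, _, (Matrix.cons_head_tail e₁).symm⟩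
    obtain ⟨h₂, e₂, A₂, hA₁₂, hA₂⟩ := ih A₁.tail
    have ha := A₁.spanSingleton_mul_le 0 0
    rw [hsplit.eq_diagCons_tail] at hAA₁
    exact ⟨_, _, A₂.diagCons (A₁.mat 0 0) ha, hAA₁.trans (hA₁₂.diagCons ha),
      hA₂.diagCons ha (hA₁₂.minorIdeal_le fun i j => hle i.succ j.succ)⟩

end DiagCons

end PseudoMatrix

theorem mainTheorem8 {Z : Type*} [CommRing Z] [IsNoetherianRing Z]
    (hZ : IsPruferDomain Z) {K : Type*} [Field K] [Algebra Z K] [IsFractionRing Z K]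
    {n m : ℕ} (h : Fin n → (FractionalIdeal Z⁰ K)ˣ) (e : Fin m → (FractionalIdeal Z⁰ K)ˣ)
    (A : PseudoMatrix h e) :
    ∃ (h' : Fin n → (FractionalIdeal Z⁰ K)ˣ) (e' : Fin m → (FractionalIdeal Z⁰ K)ˣ)
      (A' : PseudoMatrix h' e'), A.Equivalent A' ∧ A'.IsSmith := by
  have := hZ.isDedekindDomain
  exact A.exists_equivalent_isSmith
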